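/- Identify $[0,2\pi]$ with the circle group (addition modulo $2\pi$), let $L^2=L^2([0,2\pi])$ be the space of square integrable complex functions, and put $\widehat f(n)=\frac1{2\pi}\int_0^{2\pi}f(t)e^{-int}\,dt$ for $f\in L^2$, $n\in\mathbb Z$. Let $\mathbb N=\{1,2,\dots\}$, let $\delta_x$ be the Dirac measure at $x$, so that $(\delta_x\ast f)(t)=f(t-x)$, and let powers of measures be convolution powers. For $k\ge 0$ let $W^k=\{f\in L^2:\sum_{n\in\mathbb Z}|n|^{2k}|\widehat f(n)|^2<\infty\}$, and let $D$ be the differential operator on $W^1$, given by $\widehat{Df}(n)=in\widehat f(n)$; $I$ is the identity operator. Let $\alpha,\beta\in\mathbb Z$. For $b\in[0,2\pi]$ let $$\mu_b=\left(e^{ib\frac{\alpha-\beta}2}+e^{-ib\frac{\alpha-\beta}2}\right)\delta_0-\left(e^{ib\frac{\alpha+\beta}2}\delta_b+e^{-ib\frac{\alpha+\beta}2}\delta_{-b}\right),\qquad \lambda_b=\tfrac12\mu_b.$$ A function $\lambda_b\ast g$ with $b\in[0,2\pi]$ and $g\in L^2$ is called a generalised difference. (A) For $f\in L^2$ the following conditions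 are equivalent. (i) $\widehat f(\alpha)=\widehat f(\beta)=0$. (ii) There are $m,s\in\mathbb N$, $b_1,\dots,b_m\in[0,2\pi]$ and $f_1,\dots,f_m\in L^2$ with $f=\sum_{j=1}^m\mu_{b_j}^s\ast f_j$. (iii) There are $s\in\mathbb N$, $b_1,\dots,b_{4s+1}\in[0,2\pi]$ and $f_1,\dots,f_{4s+1}\in L^2$ with $f=\sum_{j=1}^{4s+1}\mu_{b_j}^s\ast f_j$. (iv) There are $s\in\mathbb N$ and $g\in W^{2s}$ with $\left(D^2-i(\alpha+\beta)D-\alpha\beta I\right)^s(g)=f$. (iv') There are $s\in\mathbb N$ and $g\in W^{2s}$ with $\left(D^2-i(\alpha+\beta)D-\alpha\beta I\right)(g)=f$. (B) For each given $s\in\mathbb N$, the conditions (i), (ii), (iii), (iv) with this value of $s$ are equivalent for every $f\in L^2$. (C) Let $s\in\mathbb N$, and let $f\in L^2$ satisfy these conditions. Then for almost all $(b_1,\dots,b_{4s+1})\in[0,2\pi]^{4s+1}$ there are $f_1,\dots,f_{4s+1}\in L^2$ with $f=\sum_{j=1}^{4s+1}\mu_{b_j}^s\ast f_j$. (D) For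 each $s\in\mathbb N$, the functions $f\in L^2$ that can be written as $f=\sum_{j=1}^{4s+1}\mu_{b_j}^s\ast f_j$ with $b_j\in[0,2\pi]$ and $f_j\in L^2$ form a closed vector subspace of $L^2$. (E) In particular (the case $s=1$), every $f\in L^2$ with $\widehat f(\alpha)=\widehat f(\beta)=0$ is a sum of five generalised differences. -/

import Mathlib

open MeasureTheory

noncomputable section

namespace GenDiff

instance twoPiPos : Fact (0 < 2 * Real.pi) := ⟨Real.two_pi_pos⟩

/-- The circle group `[0,2π)` with addition modulo `2π`. -/
abbrev Circ : Type := AddCircle (2 * Real.pi)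

/-- `L²([0,2π]) = L²(𝕋)`, complex valued, with respect to `dt/(2π)`. -/
abbrev L2 : Type := Lp ℂ 2 (AddCircle.haarAddCircle : Measure Circ)

/-- The Fourier coefficient `f̂(n) = (1/2π) ∫₀^{2π} f(t) e^{-int} dt`. -/
def coef (f : L2) (n : ℤ) : ℂ := fourierCoeff (f : Circ → ℂ) n

/-! ### Finitely supported complex measures and their convolution -/

/-- The algebra of finitely supported complex measures `∑ c_x δ_x` on the circle: the group
algebra, whose product is the convolution of measures, so that `μ ^ s` is the `s`-fold
convolution power. -/
abbrev FinMeas : Type := AddMonoidAlgebra ℂ Circ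

/-- The Dirac measure at (the class modulo `2π` of) the real number `x`. -/
def dirac (x : ℝ) : FinMeas := AddMonoidAlgebra.single (x : Circ) (1 : ℂ)

/-- `δ_b ∗ f`, that is, the function `x ↦ f (x - b)`. -/
def translate (b : Circ) : L2 →ₗᵢ[ℂ] L2 :=
  Lp.compMeasurePreservingₗᵢ ℂ (fun x : Circ => x - b)
    (measurePreserving_sub_right AddCircle.haarAddCircle b)

/-- The convolution `μ ∗ f = ∑ c_x (δ_x ∗ f)` of `μ = ∑ c_x δ_x` with `f ∈ L²`. -/
def conv (μ : FinMeas) (f : L2) : L2 :=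
  μ.coeff.sum fun b c => c • translate b f

/-- The measure `(e^{ib(α-β)/2} + e^{-ib(α-β)/2}) δ_0 - (e^{ib(α+β)/2} δ_b + e^{-ib(α+β)/2} δ_{-b})`,
where `b` is a real number. -/
def bracket (α β : ℤ) (b : ℝ) : FinMeas :=
  (Complex.exp (Complex.I * b * (((α : ℂ) - β) / 2))
      + Complex.exp (-(Complex.I * b * (((α : ℂ) - β) / 2)))) • dirac 0
    - (Complex.exp (Complex.I * b * (((α : ℂ) + β) / 2)) • dirac b
      + Complex.exp (-(Complex.I * b * (((α : ℂ) + β) / 2))) • dirac (-b))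

/-- The measure `λ_b`, one half of `bracket α β b`. -/
def lam (α β : ℤ) (b : ℝ) : FinMeas := (1 / 2 : ℂ) • bracket α β b

/-- `h` is a generalised difference: `h = λ_b ∗ g` with `b ∈ [0,2π]` and `g ∈ L²`. -/
def IsGeneralisedDifference (α β : ℤ) (h : L2) : Prop :=
  ∃ b ∈ Set.Icc (0 : ℝ) (2 * Real.pi), ∃ g : L2, h = conv (lam α β b) g

/-- `f = ∑_{j=1}^m [⋯]_{b_j}^s ∗ f_j` for some `f_1, …, f_m ∈ L²`. -/
def IsSumWith (α β : ℤ) (s : ℕ) {m : ℕ} (b : Fin m → ℝ) (f : L2) : Prop :=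
  ∃ g : Fin m → L2, f = ∑ j, conv (bracket α β (b j) ^ s) (g j)

/-- `f = ∑_{j=1}^m [⋯]_{b_j}^s ∗ f_j` for some `b_j ∈ [0,2π]` and `f_j ∈ L²`. -/
def IsSum (α β : ℤ) (s m : ℕ) (f : L2) : Prop :=
  ∃ b : Fin m → ℝ, (∀ j, b j ∈ Set.Icc (0 : ℝ) (2 * Real.pi)) ∧ IsSumWith α β s b f

/-! ### Sobolev spaces and the differential operator -/

lemma coef_eq_repr (f : L2) (n : ℤ) : coef f n = fourierBasis.repr f n :=
  (fourierBasis_repr f n).symm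

lemma coef_zero (n : ℤ) : coef 0 n = 0 := by simp [coef_eq_repr]

lemma coef_add (f g : L2) (n : ℤ) : coef (f + g) n = coef f n + coef g n := by
  simp [coef_eq_repr]

lemma coef_smul (c : ℂ) (f : L2) (n : ℤ) : coef (c • f) n = c * coef f n := by
  simp [coef_eq_repr]

lemma coef_ext {f g : L2} (h : ∀ n, coef f n = coef g n) : f = g := by
  apply fourierBasis.repr.injective
  ext n
  simpa [coef_eq_repr] using h n

lemma summable_coef_sq (f : L2) : Summable fun n : ℤ => ‖coef f n‖ ^ 2 :=
  (hasSum_sq_fourierCoeff f).summable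

/-- The Sobolev space `W^k = {f ∈ L² : ∑ |n|^{2k} |f̂(n)|² < ∞}`. -/
def W (k : ℕ) : Submodule ℂ L2 where
  carrier := {f | Summable fun n : ℤ => |(n : ℝ)| ^ (2 * k) * ‖coef f n‖ ^ 2}
  zero_mem' := by simp [coef_zero, summable_zero]
  add_mem' := by
    intro f g hf hg
    refine Summable.of_nonneg_of_le (fun n => by positivity) (fun n => ?_)
      ((hf.mul_left 2).add (hg.mul_left 2))
    have h1 : ‖coef (f + g) n‖ ^ 2 ≤ 2 * ‖coef f n‖ ^ 2 + 2 * ‖coef g n‖ ^ 2 := by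
      rw [coef_add]
      have := norm_add_le (coef f n) (coef g n)
      nlinarith [sq_nonneg (‖coef f n‖ - ‖coef g n‖), norm_nonneg (coef f n + coef g n)]
    have h2 : 0 ≤ |(n : ℝ)| ^ (2 * k) := by positivity
    nlinarith [mul_le_mul_of_nonneg_left h1 h2]
  smul_mem' := by
    intro c f hf
    refine (hf.mul_left (‖c‖ ^ 2)).congr fun n => ?_
    rw [coef_smul, norm_mul]
    ring

lemma mem_W {k : ℕ} {f : L2} :
    f ∈ W k ↔ Summable fun n : ℤ => |(n : ℝ)| ^ (2 * k) * ‖coef f n‖ ^ 2 := Iff.rfl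

lemma W_succ_le (k : ℕ) : W (k + 1) ≤ W k := by
  intro f hf
  refine Summable.of_nonneg_of_le (fun n => by positivity) (fun n => ?_)
    ((summable_coef_sq f).add hf)
  have h : |(n : ℝ)| ^ (2 * k) ≤ 1 + |(n : ℝ)| ^ (2 * (k + 1)) := by
    rcases le_total (|(n : ℝ)|) 1 with h | h
    · have := pow_le_one₀ (n := 2 * k) (abs_nonneg (n : ℝ)) h
      have : 0 ≤ |(n : ℝ)| ^ (2 * (k + 1)) := by positivity
      linarith
    · have := pow_le_pow_right₀ h (show 2 * k ≤ 2 * (k + 1) by omega)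
      linarith
  nlinarith [mul_le_mul_of_nonneg_right h (sq_nonneg ‖coef f n‖)]

/-- The inclusion of `W^{k+1}` in `W^k`. -/
def incl (k : ℕ) : W (k + 1) →ₗ[ℂ] W k := Submodule.inclusion (W_succ_le k)

lemma W_le_one (k : ℕ) : W (k + 1) ≤ W 1 := by
  induction k with
  | zero => exact le_rfl
  | succ k ih => exact (W_succ_le (k + 1)).trans ih

lemma memlp_D {f : L2} (hf : f ∈ W 1) :
    Memℓp (fun n : ℤ => Complex.I * (n : ℂ) * coef f n) 2 := by
  refine memℓp_gen ?_
  have h := mem_W.1 hf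
  refine h.congr fun n => ?_
  simp only [norm_mul, Complex.norm_I, one_mul, Complex.norm_intCast, ENNReal.toReal_ofNat,
    Real.rpow_ofNat]
  ring

/-- `D f` for `f ∈ W¹`: the element of `L²` with Fourier coefficients `i n f̂(n)`. -/
def deriv1 (f : W 1) : L2 :=
  fourierBasis.repr.symm ⟨fun n : ℤ => Complex.I * (n : ℂ) * coef f n, memlp_D f.2⟩

lemma coef_deriv1 (f : W 1) (n : ℤ) :
    coef (deriv1 f) n = Complex.I * (n : ℂ) * coef f n := by
  simp [coef_eq_repr, deriv1]

/-- The differential operator `D`, as a linear map `W^{k+1} → W^k`. -/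
def D (k : ℕ) : W (k + 1) →ₗ[ℂ] W k where
  toFun f := ⟨deriv1 ⟨f, W_le_one k f.2⟩, by
    refine (mem_W.1 f.2).congr fun n => ?_
    rw [coef_deriv1]
    simp only [norm_mul, Complex.norm_I, one_mul, Complex.norm_intCast]
    ring⟩
  map_add' f g := by
    apply Subtype.ext
    apply coef_ext
    intro n
    simp only [Submodule.coe_add, coef_add, coef_deriv1]
    ring
  map_smul' c f := by
    apply Subtype.ext
    apply coef_ext
    intro n
    simp only [Submodule.coe_smul, coef_smul, coef_deriv1, RingHom.id_apply]
    ring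

lemma coef_D (k : ℕ) (f : W (k + 1)) (n : ℤ) :
    coef (D k f : L2) n = Complex.I * (n : ℂ) * coef (f : L2) n := coef_deriv1 _ n

/-- The operator `D² - i(α+β)D - αβ I`, as a linear map `W^{k+2} → W^k`. -/
def P (α β : ℤ) (k : ℕ) : W (k + 2) →ₗ[ℂ] W k :=
  D k ∘ₗ D (k + 1) - (Complex.I * ((α : ℂ) + β)) • (incl k ∘ₗ D (k + 1))
    - ((α : ℂ) * β) • (incl k ∘ₗ incl (k + 1))

/-- The operator `(D² - i(α+β)D - αβ I)^s : W^{2s} → L²`. -/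
def Ppow (α β : ℤ) : (s : ℕ) → W (2 * s) →ₗ[ℂ] L2
  | 0 => (W 0).subtype
  | s + 1 => Ppow α β s ∘ₗ P α β (2 * s)

end GenDiff

end

noncomputable section

namespace GenDiff

open scoped ENNReal

/-! ### Fourier coefficients of convolutions -/

/-! Everything is read off Fourier coefficients. Up to a unimodular factor, `hat n (bracket α β b)`
is `(e^{i(n-α)b} - 1)(e^{i(n-β)b} - 1)`, and the symbol of the differential operator is
`-(n-α)(n-β)`. Both vanish at `n = α, β`, which gives necessity.

For the operator, sufficiency is division by the symbol (`exists_mem_W_coef_eq`). For sums, it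
suffices that `∑ₙ |f̂(n)|² / weight(n, b)` be finite (`isSumWith_of_tsum_lt_top`). This holds for
almost every `b` by Tonelli, once the integral of `1 / weight` over the cube is bounded uniformly in
`n ≠ α, β` (`exists_lintegral_inv_weight_le`). That integral is dominated by a product of
one-variable integrals with singularities of order `4s/m`, integrable for `m = 4s + 1`. Uniformity
in `n` comes from invariance of Haar measure under `b ↦ p • b`, `p ≠ 0`. -/

/-- The Fourier transform `μ ↦ μ̂(n)` of finitely supported measures, an algebra homomorphism. -/
def hat (n : ℤ) : FinMeas →ₐ[ℂ] ℂ :=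
  AddMonoidAlgebra.lift ℂ ℂ Circ
    { toFun := fun x => fourier (-n) x.toAdd
      map_one' := by simp
      map_mul' := fun x y => by simp [fourier_apply, AddCircle.toCircle_add] }

lemma hat_dirac (n : ℤ) (x : ℝ) : hat n (dirac x) = Complex.exp (-(Complex.I * n * x)) := by
  have h : hat n (dirac x) = fourier (-n) (x : Circ) := by
    simp [hat, dirac, AddMonoidAlgebra.lift_single]
  rw [h, fourier_coe_apply]
  congr 1
  have : (Real.pi : ℂ) ≠ 0 := by exact_mod_cast Real.pi_ne_zero
  push_cast
  field_simp

lemma coef_translate (x : Circ) (f : L2) (n : ℤ) :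
    coef (translate x f) n = fourier (-n) x * coef f n := by
  have h : (translate x f : Circ → ℂ) =ᵐ[AddCircle.haarAddCircle] fun y => f (y - x) :=
    Lp.coeFn_compMeasurePreserving f (measurePreserving_sub_right AddCircle.haarAddCircle x)
  rw [coef, fourierCoeff_congr_ae h, coef, fourierCoeff, fourierCoeff, ← integral_const_mul,
    ← integral_sub_right_eq_self (fun y => fourier (-n) x * (fourier (-n) y • f y)) x]
  congr 1 with y
  have : fourier (-n) y = fourier (-n) x * fourier (-n) (y - x) := by
    simp only [fourier_apply]
    rw [← Circle.coe_mul, ← AddCircle.toCircle_add, ← smul_add, add_sub_cancel]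
  rw [this, smul_eq_mul, smul_eq_mul, mul_assoc]

/-- The `n`-th Fourier coefficient, as a linear map. -/
def coefₗ (n : ℤ) : L2 →ₗ[ℂ] ℂ where
  toFun f := coef f n
  map_add' f g := coef_add f g n
  map_smul' c f := coef_smul c f n

lemma coef_sum {ι : Type*} (s : Finset ι) (f : ι → L2) (n : ℤ) :
    coef (∑ i ∈ s, f i) n = ∑ i ∈ s, coef (f i) n :=
  map_sum (coefₗ n) f s

lemma continuous_coef (n : ℤ) : Continuous fun f : L2 => coef f n := by
  have h : (fun f : L2 => coef f n) = fun f => inner ℂ (fourierBasis n) f := by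
    funext f
    rw [coef_eq_repr, HilbertBasis.repr_apply_apply]
  rw [h]
  fun_prop

lemma coef_conv (μ : FinMeas) (f : L2) (n : ℤ) : coef (conv μ f) n = hat n μ * coef f n := by
  rw [conv, Finsupp.sum, coef_sum, hat, AddMonoidAlgebra.lift_apply, Finsupp.sum, Finset.sum_mul]
  refine Finset.sum_congr rfl fun x _ => ?_
  rw [coef_smul, coef_translate, ← mul_assoc]
  rfl

lemma hat_bracket (α β n : ℤ) (b : ℝ) :
    hat n (bracket α β b) =
      -Complex.exp (-(Complex.I * b * (n - ((α : ℂ) + β) / 2))) *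
        ((Complex.exp (Complex.I * (((n - α : ℤ) * b : ℝ) : ℂ)) - 1) *
          (Complex.exp (Complex.I * (((n - β : ℤ) * b : ℝ) : ℂ)) - 1)) := by
  have key (z u v : ℂ) : -Complex.exp z * ((Complex.exp u - 1) * (Complex.exp v - 1)) =
      Complex.exp (z + u) + Complex.exp (z + v) - (Complex.exp z + Complex.exp (z + u + v)) := by
    simp only [Complex.exp_add]
    ring
  simp only [key, bracket, map_sub, map_add, map_smul, hat_dirac, smul_eq_mul,
    ← Complex.exp_add]
  push_cast
  simp only [mul_zero, neg_zero, Complex.exp_zero, mul_one]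
  ring_nf

lemma hat_bracket_left (α β : ℤ) (b : ℝ) : hat α (bracket α β b) = 0 := by simp [hat_bracket]

lemma hat_bracket_right (α β : ℤ) (b : ℝ) : hat β (bracket α β b) = 0 := by simp [hat_bracket]

/-- The distance from `1` of the point of the unit circle with argument `x`. -/
def chord (x : Circ) : ℝ≥0∞ := ‖(fourier 1 x : ℂ) - 1‖ₑ

lemma measurable_chord : Measurable chord := by
  unfold chord
  exact ((fourier 1).continuous.sub continuous_const).enorm.measurable

lemma chord_coe (x : ℝ) : chord x = ‖Complex.exp (Complex.I * x) - 1‖ₑ := by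
  rw [chord, fourier_coe_apply]
  congr 3
  have : (Real.pi : ℂ) ≠ 0 := by exact_mod_cast Real.pi_ne_zero
  push_cast
  field_simp

lemma enorm_hat_bracket (α β n : ℤ) (b : ℝ) :
    ‖hat n (bracket α β b)‖ₑ = chord ((n - α) • (b : Circ)) * chord ((n - β) • (b : Circ)) := by
  have h (k : ℤ) : k • (b : Circ) = ((k * b : ℝ) : Circ) := by
    rw [← AddCircle.coe_zsmul, zsmul_eq_mul]
  rw [h, h, chord_coe, chord_coe, hat_bracket, enorm_mul, enorm_mul, enorm_neg]
  have h1 : ‖Complex.exp (-(Complex.I * b * (n - ((α : ℂ) + β) / 2)))‖ₑ = 1 := by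
    rw [← ofReal_norm, Complex.norm_exp]
    simp
  rw [h1, one_mul]

/-! ### The integral estimate -/

/-- The chord is `2|sin(x/2)|`, so this is Jordan's inequality; it shows that `chord` has only a
first-order zero. -/
lemma chord_lower_bound {x : ℝ} (hx : |x| ≤ Real.pi) :
    ENNReal.ofReal (2 / Real.pi * |x|) ≤ chord x := by
  rw [chord_coe, ← ofReal_norm]
  refine ENNReal.ofReal_le_ofReal ?_
  rw [Complex.norm_exp_I_mul_ofReal_sub_one, Real.norm_eq_abs, abs_mul, abs_two]
  have h := Real.mul_abs_le_abs_sin (x := x / 2) (by rw [abs_div, abs_two]; linarith)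
  rw [abs_div, abs_two] at h
  linarith

lemma lintegral_chord_rpow_lt_top {θ : ℝ} (h0 : 0 ≤ θ) (h1 : θ < 1) :
    ∫⁻ x : Circ, chord x ^ (-θ) < ∞ := by
  -- The fundamental domain `(-π, π]` puts the only singularity at its centre.
  rw [← AddCircle.lintegral_preimage (2 * Real.pi) (-Real.pi)]
  have hint : IntegrableOn (fun x : ℝ => (2 / Real.pi) ^ (-θ) * |x| ^ (-θ))
      (Set.Ioc (-Real.pi) (-Real.pi + 2 * Real.pi)) := by
    refine Integrable.const_mul ?_ _
    have : IntervalIntegrable (fun x : ℝ => |x| ^ (-θ)) volume (-Real.pi)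
        (-Real.pi + 2 * Real.pi) := by
      refine intervalIntegrable_of_even (fun x => by rw [abs_neg]) fun x hx => ?_
      refine (intervalIntegral.intervalIntegrable_rpow' (r := -θ) (by linarith)).congr ?_
      intro y hy
      rw [Set.uIoc_of_le hx.le] at hy
      simp only [abs_of_pos hy.1]
    exact (intervalIntegrable_iff_integrableOn_Ioc_of_le (by linarith [Real.pi_pos])).1 this
  refine lt_of_le_of_lt ?_ hint.lintegral_lt_top
  refine lintegral_mono_ae ?_
  refine (ae_restrict_iff' measurableSet_Ioc).2 ?_
  -- For `θ > 0` the point `0` must be discarded: there the real power is `0` by convention, while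
  -- the extended one is `∞`.
  filter_upwards [compl_mem_ae_iff.2 (measure_singleton (0 : ℝ))] with x hx0 hx
  have hx0 : 0 < |x| := abs_pos.2 hx0
  have hx' : |x| ≤ Real.pi := abs_le.2 ⟨hx.1.le, by linarith [hx.2]⟩
  have hpi := Real.pi_pos
  rw [← Real.mul_rpow (by positivity) (by positivity),
    ← ENNReal.ofReal_rpow_of_pos (by positivity)]
  rw [ENNReal.rpow_neg, ENNReal.rpow_neg]
  exact ENNReal.inv_le_inv.2 (ENNReal.rpow_le_rpow (chord_lower_bound hx') h0)

lemma lintegral_chord_zsmul_rpow {θ : ℝ} {p : ℤ} (hp : p ≠ 0) :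
    ∫⁻ b : ℝ in Set.Icc 0 (2 * Real.pi), chord (p • (b : Circ)) ^ (-θ) =
      ∫⁻ x : Circ, chord x ^ (-θ) := by
  rw [← Measure.restrict_congr_set Ioc_ae_eq_Icc]
  have h := AddCircle.lintegral_preimage (2 * Real.pi) 0 fun x : Circ => chord (p • x) ^ (-θ)
  rw [zero_add] at h
  rw [h]
  exact (Measure.measurePreserving_zsmul (volume : Measure Circ) hp).lintegral_comp
    (measurable_chord.pow_const (-θ))

lemma lintegral_pi_prod {Ω : Type*} [MeasurableSpace Ω] (μ : Measure Ω) [SigmaFinite μ]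
    {g : Ω → ℝ≥0∞} (hg : Measurable g) (m : ℕ) :
    ∫⁻ x, ∏ j, g (x j) ∂(Measure.pi fun _ : Fin m => μ) = (∫⁻ y, g y ∂μ) ^ m := by
  induction m with
  | zero => simp
  | succ m ih =>
    have h := measurePreserving_piFinSuccAbove (fun _ : Fin (m + 1) => μ) 0
    rw [← h.symm.lintegral_comp_emb (MeasurableEquiv.measurableEmbedding _), pow_succ', ← ih, ← lintegral_prod_mul hg.aemeasurable]
    · refine lintegral_congr fun z => ?_
      simp [Fin.prod_univ_succ, MeasurableEquiv.piFinSuccAbove]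
    · exact (Finset.measurable_prod _ fun j _ =>
        hg.comp (measurable_pi_apply j)).aemeasurable

/-- Since `xy ≥ min(x, y)²`, the left side is at most `min(x, y)^(-4sr)`, which is one of the two
summands. A sum is needed because the two chords may vanish at the same `b`; separately, each can be
integrated by rescaling. -/
lemma rpow_neg_le_add {s : ℕ} {r : ℝ} (hr : 0 ≤ r) {x y S : ℝ≥0∞} (h : (x * y) ^ (2 * s) ≤ S) :
    S ^ (-r) ≤ x ^ (-(4 * s * r)) + y ^ (-(4 * s * r)) := by
  have key {x y : ℝ≥0∞} (hxy : x ≤ y) (h : (x * y) ^ (2 * s) ≤ S) :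
      S ^ (-r) ≤ x ^ (-(4 * s * r)) := by
    have h1 : x ^ (4 * s) ≤ S := by
      refine le_trans ?_ h
      rw [show 4 * s = 2 * (2 * s) by ring, pow_mul x, sq]
      gcongr
    rw [ENNReal.rpow_neg, ENNReal.rpow_neg, ENNReal.inv_le_inv, ENNReal.rpow_mul]
    refine ENNReal.rpow_le_rpow ?_ hr
    have : x ^ (4 * (s : ℝ)) = x ^ (4 * s) := by
      rw [← ENNReal.rpow_natCast]; push_cast; rfl
    rwa [this]
  rcases le_total x y with hxy | hxy
  · exact (key hxy h).trans le_self_add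
  · exact (key hxy (by rwa [mul_comm])).trans le_add_self

/-- The sum `∑ |μ̂_{b_j}(n)|^{2s}`. -/
def weight (α β : ℤ) (s : ℕ) {m : ℕ} (n : ℤ) (b : Fin m → ℝ) : ℝ≥0∞ :=
  ∑ j, ‖hat n (bracket α β (b j))‖ₑ ^ (2 * s)

lemma measurable_weight (α β : ℤ) (s : ℕ) {m : ℕ} (n : ℤ) :
    Measurable (weight α β s (m := m) n) := by
  unfold weight
  simp only [enorm_hat_bracket]
  have h (k : ℤ) (j : Fin m) : Measurable fun b : Fin m → ℝ => chord (k • (b j : Circ)) :=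
    measurable_chord.comp ((measurable_const_smul k).comp
      (AddCircle.measurable_mk'.comp (measurable_pi_apply j)))
  exact Finset.measurable_sum _ fun j _ => ((h _ j).mul (h _ j)).pow_const _

/-- The inverse weight is split into `m` equal powers, and in the `j`-th one the weight is bounded
below by its `j`-th summand. This separates the variables and lowers the order of the singularity to
`4s/m`. -/
lemma inv_weight_le (α β : ℤ) (s : ℕ) {m : ℕ} (hm : m ≠ 0) (n : ℤ) (b : Fin m → ℝ) :
    (weight α β s n b)⁻¹ ≤ ∏ j, (chord ((n - α) • (b j : Circ)) ^ (-(4 * s * (m : ℝ)⁻¹)) +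
      chord ((n - β) • (b j : Circ)) ^ (-(4 * s * (m : ℝ)⁻¹))) := by
  have hm' : (m : ℝ) ≠ 0 := by exact_mod_cast hm
  have h : (weight α β s n b)⁻¹ = ∏ _j : Fin m, weight α β s n b ^ (-(m : ℝ)⁻¹) := by
    rw [Finset.prod_const, Finset.card_univ, Fintype.card_fin, ← ENNReal.rpow_natCast,
      ← ENNReal.rpow_mul, neg_mul, inv_mul_cancel₀ hm', ENNReal.rpow_neg_one]
  rw [h]
  refine Finset.prod_le_prod' fun j _ => rpow_neg_le_add (by positivity) ?_
  rw [← enorm_hat_bracket]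
  exact Finset.single_le_sum (f := fun j => ‖hat n (bracket α β (b j))‖ₑ ^ (2 * s))
    (fun _ _ => zero_le) (Finset.mem_univ j)

lemma exists_lintegral_inv_weight_le (α β : ℤ) (s : ℕ) :
    ∃ C : ℝ≥0∞, C < ∞ ∧ ∀ n : ℤ, n ≠ α → n ≠ β →
      ∫⁻ b : Fin (4 * s + 1) → ℝ in Set.univ.pi fun _ => Set.Icc (0 : ℝ) (2 * Real.pi),
        (weight α β s n b)⁻¹ ≤ C := by
  -- The number `4s + 1` of variables is the least that makes this exponent smaller than `1`.
  set θ : ℝ := 4 * s * ((4 * s + 1 : ℕ) : ℝ)⁻¹ with hθ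
  have h0 : 0 ≤ θ := by positivity
  have h1 : θ < 1 := by
    rw [hθ, ← div_eq_mul_inv, div_lt_one (by positivity)]
    push_cast
    linarith
  refine ⟨((∫⁻ x : Circ, chord x ^ (-θ)) + ∫⁻ x : Circ, chord x ^ (-θ)) ^ (4 * s + 1), ?_, ?_⟩
  · have := lintegral_chord_rpow_lt_top h0 h1
    exact ENNReal.pow_lt_top (ENNReal.add_lt_top.2 ⟨this, this⟩)
  intro n hα hβ
  have hmeas (k : ℤ) : Measurable fun b : ℝ => chord (k • (b : Circ)) ^ (-θ) :=
    (measurable_chord.comp ((measurable_const_smul k).comp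
      AddCircle.measurable_mk')).pow_const _
  refine (lintegral_mono fun b => inv_weight_le α β s (by omega) n b).trans ?_
  rw [volume_pi, Measure.restrict_pi_pi,
    lintegral_pi_prod (volume.restrict (Set.Icc 0 (2 * Real.pi)))
      (g := fun b : ℝ => chord ((n - α) • (b : Circ)) ^ (-θ) + chord ((n - β) • (b : Circ)) ^ (-θ))
      ((hmeas _).add (hmeas _)),
    lintegral_add_left (hmeas _), lintegral_chord_zsmul_rpow (sub_ne_zero.2 hα),
    lintegral_chord_zsmul_rpow (sub_ne_zero.2 hβ)]

/-! ### Sums of generalised differences -/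

lemma exists_coef_eq {a : ℤ → ℂ} (ha : Summable fun n => ‖a n‖ ^ 2) :
    ∃ g : L2, ∀ n, coef g n = a n := by
  have h : Memℓp a 2 := memℓp_gen (by simpa using ha)
  exact ⟨fourierBasis.repr.symm ⟨a, h⟩, fun n => by simp [coef_eq_repr]⟩

lemma toReal_weight (α β : ℤ) (s : ℕ) {m : ℕ} (n : ℤ) (b : Fin m → ℝ) :
    (weight α β s n b).toReal = ∑ j, ‖hat n (bracket α β (b j))‖ ^ (2 * s) := by
  rw [weight, ENNReal.toReal_sum fun j _ => ENNReal.pow_ne_top enorm_ne_top]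
  simp

lemma weight_ne_top (α β : ℤ) (s : ℕ) {m : ℕ} (n : ℤ) (b : Fin m → ℝ) :
    weight α β s n b ≠ ∞ :=
  ENNReal.sum_ne_top.2 fun _ _ => ENNReal.pow_ne_top enorm_ne_top

lemma isSumWith_of_tsum_lt_top {α β : ℤ} {s m : ℕ} {b : Fin m → ℝ} {f : L2}
    (h : ∑' n, ‖coef f n‖ₑ ^ 2 * (weight α β s n b)⁻¹ < ∞) : IsSumWith α β s b f := by
  set w : ℤ → ℝ := fun n => ∑ j, ‖hat n (bracket α β (b j))‖ ^ (2 * s) with hw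
  have hsum : Summable fun n => ‖coef f n‖ ^ 2 * (w n)⁻¹ := by
    refine (ENNReal.summable_toReal h.ne).congr fun n => ?_
    rw [ENNReal.toReal_mul, ENNReal.toReal_inv, toReal_weight]
    simp [hw]
  -- In `ℝ≥0∞` a zero weight has inverse `∞`, so finiteness of the sum forces the coefficient to
  -- vanish; the real inverse `0⁻¹ = 0` would not see this.
  have hzero (n : ℤ) (hn : w n = 0) : coef f n = 0 := by
    by_contra hf
    have h0 : weight α β s n b = 0 := by
      simp only [hw] at hn
      rw [← toReal_weight, ENNReal.toReal_eq_zero_iff] at hn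
      exact hn.resolve_right (weight_ne_top α β s n b)
    have := ENNReal.ne_top_of_tsum_ne_top h.ne n
    rw [h0, ENNReal.inv_zero, ENNReal.mul_top (pow_ne_zero _ (enorm_ne_zero.2 hf))] at this
    exact this rfl
  -- The least-squares solution of `∑ⱼ μ̂ⱼ(n)^s aⱼ(n) = f̂(n)`, for which `∑ⱼ |aⱼ(n)|² = |f̂(n)|² /
  -- w(n)`.
  let a (j : Fin m) (n : ℤ) : ℂ :=
    (starRingEnd ℂ) (hat n (bracket α β (b j)) ^ s) * coef f n * ((w n : ℝ) : ℂ)⁻¹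
  have ha (j : Fin m) : Summable fun n => ‖a j n‖ ^ 2 := by
    refine Summable.of_nonneg_of_le (fun _ => by positivity) (fun n => ?_) hsum
    have hwn : 0 ≤ w n := Finset.sum_nonneg fun _ _ => by positivity
    have hle : ‖hat n (bracket α β (b j))‖ ^ (2 * s) ≤ w n :=
      Finset.single_le_sum (f := fun j => ‖hat n (bracket α β (b j))‖ ^ (2 * s))
        (fun _ _ => by positivity) (Finset.mem_univ j)
    have heq : ‖a j n‖ ^ 2 =
        ‖coef f n‖ ^ 2 * (w n)⁻¹ * (‖hat n (bracket α β (b j))‖ ^ (2 * s) * (w n)⁻¹) := by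
      simp only [a, norm_mul, norm_inv, RCLike.norm_conj, norm_pow, Complex.norm_real,
        Real.norm_of_nonneg hwn]
      ring
    rw [heq]
    refine mul_le_of_le_one_right (by positivity) ?_
    rw [← div_eq_mul_inv]
    exact div_le_one_of_le₀ hle hwn
  choose g hg using fun j => exists_coef_eq (ha j)
  refine ⟨g, coef_ext fun n => ?_⟩
  rw [coef_sum]
  have hterm (j : Fin m) : coef (conv (bracket α β (b j) ^ s) (g j)) n =
      ((‖hat n (bracket α β (b j))‖ ^ (2 * s) : ℝ) : ℂ) * (coef f n * ((w n : ℝ) : ℂ)⁻¹) := by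
    rw [coef_conv, hg, map_pow]
    have := Complex.mul_conj' (hat n (bracket α β (b j)) ^ s)
    rw [norm_pow] at this
    simp only [a]
    rw [← mul_assoc, ← mul_assoc, this]
    push_cast
    ring
  simp only [hterm]
  rw [← Finset.sum_mul, ← Complex.ofReal_sum]
  change _ = ((w n : ℝ) : ℂ) * _
  rcases eq_or_ne (w n) 0 with h0 | h0
  · simp [hzero n h0]
  · have : ((w n : ℝ) : ℂ) ≠ 0 := by exact_mod_cast h0
    field_simp

lemma ae_isSumWith (α β : ℤ) (s : ℕ) {f : L2} (hf : coef f α = 0 ∧ coef f β = 0) :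
    ∀ᵐ b : Fin (4 * s + 1) → ℝ ∂(volume.restrict
      (Set.univ.pi fun _ => Set.Icc (0 : ℝ) (2 * Real.pi))), IsSumWith α β s b f := by
  obtain ⟨C, hC, hle⟩ := exists_lintegral_inv_weight_le α β s
  have hmeas (n : ℤ) : Measurable fun b : Fin (4 * s + 1) → ℝ => (weight α β s n b)⁻¹ :=
    (measurable_weight α β s n).inv
  have hfin : ∫⁻ b : Fin (4 * s + 1) → ℝ in Set.univ.pi fun _ => Set.Icc (0 : ℝ) (2 * Real.pi),
      ∑' n, ‖coef f n‖ₑ ^ 2 * (weight α β s n b)⁻¹ ≠ ∞ := by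
    rw [lintegral_tsum fun n => ((hmeas n).const_mul _).aemeasurable]
    refine ne_top_of_le_ne_top (b := ∑' n, ‖coef f n‖ₑ ^ 2 * C) ?_
      (ENNReal.tsum_le_tsum fun n => ?_)
    · rw [ENNReal.tsum_mul_right]
      refine ENNReal.mul_ne_top ?_ hC.ne
      have := (summable_coef_sq f).tsum_ofReal_ne_top
      simpa [ENNReal.ofReal_pow, ofReal_norm] using this
    · rw [lintegral_const_mul _ (hmeas n)]
      -- The bound `C` is not available at `α` and `β`; there the zero coefficient removes the term,
      -- even against an infinite integral.
      rcases eq_or_ne n α with rfl | hα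
      · simp [hf.1]
      rcases eq_or_ne n β with rfl | hβ
      · simp [hf.2]
      exact mul_le_mul_right (hle n hα hβ) _
  filter_upwards [ae_lt_top' (AEMeasurable.tsum fun n =>
    ((hmeas n).const_mul _).aemeasurable) hfin] with b hb
  exact isSumWith_of_tsum_lt_top hb

lemma isSum_of_coef_eq_zero {α β : ℤ} (s : ℕ) {f : L2} (hf : coef f α = 0 ∧ coef f β = 0) :
    IsSum α β s (4 * s + 1) f := by
  have hcube : MeasurableSet (Set.univ.pi fun _ : Fin (4 * s + 1) =>
      Set.Icc (0 : ℝ) (2 * Real.pi)) :=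
    MeasurableSet.univ_pi fun _ => measurableSet_Icc
  have hne : (volume.restrict (Set.univ.pi fun _ : Fin (4 * s + 1) =>
      Set.Icc (0 : ℝ) (2 * Real.pi))) ≠ 0 := by
    rw [Ne, Measure.restrict_eq_zero, volume_pi_pi]
    simp [Real.pi_pos]
  have : (ae (volume.restrict (Set.univ.pi fun _ : Fin (4 * s + 1) =>
      Set.Icc (0 : ℝ) (2 * Real.pi)))).NeBot := ae_neBot.2 hne
  obtain ⟨b, hb, hmem⟩ := ((ae_isSumWith α β s hf).and (ae_restrict_mem hcube)).exists
  exact ⟨b, fun j => hmem j (Set.mem_univ j), hb⟩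

lemma coef_eq_zero_of_isSum {α β : ℤ} {s m : ℕ} (hs : 1 ≤ s) {f : L2} (h : IsSum α β s m f) :
    coef f α = 0 ∧ coef f β = 0 := by
  obtain ⟨b, -, g, rfl⟩ := h
  have hs : s ≠ 0 := by omega
  constructor
  · simp [coef_sum, coef_conv, hat_bracket_left, hs]
  · simp [coef_sum, coef_conv, hat_bracket_right, hs]

lemma conv_bracket_eq_conv_lam (α β : ℤ) (b : ℝ) (g : L2) :
    conv (bracket α β b) g = conv (lam α β b) ((2 : ℂ) • g) := by
  refine coef_ext fun n => ?_
  rw [coef_conv, coef_conv, coef_smul, lam, map_smul, smul_eq_mul]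
  ring

/-- The functions whose Fourier coefficients at `α` and `β` vanish. -/
def vanishing (α β : ℤ) : Submodule ℂ L2 := LinearMap.ker (coefₗ α) ⊓ LinearMap.ker (coefₗ β)

lemma isClosed_vanishing (α β : ℤ) : IsClosed (vanishing α β : Set L2) :=
  (isClosed_eq (continuous_coef α) continuous_const).inter
    (isClosed_eq (continuous_coef β) continuous_const)

/-! ### The range of the differential operator -/

lemma coef_P (α β : ℤ) (k : ℕ) (g : W (k + 2)) (n : ℤ) :
    coef (P α β k g : L2) n = -(((n : ℂ) - α) * (n - β)) * coef (g : L2) n := by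
  have h1 : coef (P α β k g : L2) n = coef (D k (D (k + 1) g) : L2) n
      - Complex.I * ((α : ℂ) + β) * coef (D (k + 1) g : L2) n
      - (α : ℂ) * β * coef (g : L2) n := by
    change coefₗ n (P α β k g : L2) = _
    simp only [P, LinearMap.sub_apply, LinearMap.smul_apply, LinearMap.comp_apply,
      Submodule.coe_sub, Submodule.coe_smul, map_sub, map_smul]
    rfl
  rw [h1, coef_D, coef_D]
  linear_combination (n ^ 2 - (α + β) * n) * coef (g : L2) n * Complex.I_mul_I

lemma coef_Ppow (α β : ℤ) (s : ℕ) (g : W (2 * s)) (n : ℤ) :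
    coef (Ppow α β s g) n = (-(((n : ℂ) - α) * (n - β))) ^ s * coef (g : L2) n := by
  induction s with
  | zero => simp [Ppow]
  | succ s ih =>
    change coef (Ppow α β s (P α β (2 * s) g)) n = _
    rw [ih, coef_P, pow_succ, mul_assoc]

lemma abs_le_mul_abs_sub {n a : ℤ} (h : n ≠ a) : |(n : ℝ)| ≤ (1 + |(a : ℝ)|) * |(n : ℝ) - a| := by
  have h1 : (1 : ℝ) ≤ |(n : ℝ) - a| := by
    exact_mod_cast Int.one_le_abs (sub_ne_zero.2 h)
  have h2 : |(n : ℝ)| ≤ |(n : ℝ) - a| + |(a : ℝ)| := by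
    simpa using abs_add_le ((n : ℝ) - a) a
  nlinarith [abs_nonneg (a : ℝ)]

lemma one_le_abs_sub_mul_sub {α β n : ℤ} (hα : n ≠ α) (hβ : n ≠ β) :
    (1 : ℝ) ≤ |((n : ℝ) - α) * (n - β)| := by
  exact_mod_cast Int.one_le_abs (mul_ne_zero (sub_ne_zero.2 hα) (sub_ne_zero.2 hβ))

/-- Off `α` and `β` the symbol is a power of a nonzero integer, so division by it stays in `L²`. Its
growth of order `|n|^(2s)` supplies the `2s` derivatives. -/
lemma exists_mem_W_coef_eq {α β : ℤ} (s : ℕ) {f : L2} (hf : coef f α = 0 ∧ coef f β = 0) :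
    ∃ g ∈ W (2 * s), ∀ n : ℤ, (-(((n : ℂ) - α) * (n - β))) ^ s * coef g n = coef f n := by
  let q (n : ℤ) : ℂ := (-(((n : ℂ) - α) * (n - β))) ^ s
  have hq (n : ℤ) : ‖q n‖ = |((n : ℝ) - α) * (n - β)| ^ s := by
    simp only [q, norm_pow, norm_neg]
    rw [← Real.norm_eq_abs, ← Complex.norm_real]
    push_cast
    rfl
  have hcases (n : ℤ) : coef f n = 0 ∨ (n ≠ α ∧ n ≠ β) := by
    by_cases hα : n = α
    · exact Or.inl (hα ▸ hf.1)
    by_cases hβ : n = β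
    · exact Or.inl (hβ ▸ hf.2)
    exact Or.inr ⟨hα, hβ⟩
  have hpos {n : ℤ} (h : n ≠ α ∧ n ≠ β) : 1 ≤ ‖q n‖ := by
    rw [hq]
    exact one_le_pow₀ (one_le_abs_sub_mul_sub h.1 h.2)
  have hsum : Summable fun n => ‖(q n)⁻¹ * coef f n‖ ^ 2 := by
    refine Summable.of_nonneg_of_le (fun _ => by positivity) (fun n => ?_) (summable_coef_sq f)
    rcases hcases n with h | h
    · simp [h]
    rw [norm_mul, norm_inv]
    gcongr
    exact mul_le_of_le_one_left (norm_nonneg _) (inv_le_one_of_one_le₀ (hpos h))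
  obtain ⟨g, hg⟩ := exists_coef_eq hsum
  refine ⟨g, ?_, fun n => ?_⟩
  · rw [mem_W]
    refine Summable.of_nonneg_of_le (fun _ => by positivity) (fun n => ?_)
      ((summable_coef_sq f).mul_left ((((1 + |(α : ℝ)|) * (1 + |(β : ℝ)|)) ^ s) ^ 2))
    rw [hg]
    rcases hcases n with h | h
    · simp [h]
    have hle : |(n : ℝ)| ^ (2 * s) ≤ ((1 + |(α : ℝ)|) * (1 + |(β : ℝ)|)) ^ s * ‖q n‖ := by
      rw [hq, ← mul_pow, pow_mul, abs_mul]
      refine pow_le_pow_left₀ (by positivity) ?_ s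
      calc |(n : ℝ)| ^ 2 = |(n : ℝ)| * |(n : ℝ)| := sq _
        _ ≤ ((1 + |(α : ℝ)|) * |(n : ℝ) - α|) * ((1 + |(β : ℝ)|) * |(n : ℝ) - β|) :=
          mul_le_mul (abs_le_mul_abs_sub h.1) (abs_le_mul_abs_sub h.2) (abs_nonneg _)
            (by positivity)
        _ = _ := by ring
    have hq0 : 0 < ‖q n‖ := zero_lt_one.trans_le (hpos h)
    calc |(n : ℝ)| ^ (2 * (2 * s)) * ‖(q n)⁻¹ * coef f n‖ ^ 2
        = (|(n : ℝ)| ^ (2 * s) * ‖q n‖⁻¹ * ‖coef f n‖) ^ 2 := by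
          rw [norm_mul, norm_inv]; ring
      _ ≤ (((1 + |(α : ℝ)|) * (1 + |(β : ℝ)|)) ^ s * ‖coef f n‖) ^ 2 := by
          gcongr
          rw [← div_eq_mul_inv, div_le_iff₀ hq0]
          exact hle
      _ = _ := by rw [mul_pow]
  · rcases hcases n with h | h
    · simp [hg, h]
    have hq0 : q n ≠ 0 := norm_pos_iff.1 (zero_lt_one.trans_le (hpos h))
    rw [hg]
    exact mul_inv_cancel_left₀ hq0 _

lemma exists_Ppow_eq_iff {α β : ℤ} {s : ℕ} (hs : 1 ≤ s) {f : L2} :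
    (∃ g : W (2 * s), Ppow α β s g = f) ↔ coef f α = 0 ∧ coef f β = 0 := by
  have hs : s ≠ 0 := by omega
  constructor
  · rintro ⟨g, rfl⟩
    simp [coef_Ppow, hs]
  · intro hf
    obtain ⟨g, hg, h⟩ := exists_mem_W_coef_eq s hf
    exact ⟨⟨g, hg⟩, coef_ext fun n => by rw [coef_Ppow]; exact h n⟩

lemma exists_P_eq {α β : ℤ} {f : L2} (hf : coef f α = 0 ∧ coef f β = 0) :
    ∃ g : W 2, (P α β 0 g : L2) = f := by
  obtain ⟨g, hg, h⟩ := exists_mem_W_coef_eq 1 hf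
  exact ⟨⟨g, hg⟩, coef_ext fun n => by rw [coef_P]; simpa using h n⟩

lemma coef_P_eq_zero {α β : ℤ} {k : ℕ} (g : W (k + 2)) :
    coef (P α β k g : L2) α = 0 ∧ coef (P α β k g : L2) β = 0 := by
  simp [coef_P]

lemma isSum_iff {α β : ℤ} {s : ℕ} (hs : 1 ≤ s) {f : L2} :
    IsSum α β s (4 * s + 1) f ↔ coef f α = 0 ∧ coef f β = 0 :=
  ⟨coef_eq_zero_of_isSum hs, isSum_of_coef_eq_zero s⟩

end GenDiff

end

theorem mainTheorem1 (α β : ℤ) :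
    -- the equivalence of the conditions, with `m`, `s` quantified inside them
    (∀ f : GenDiff.L2, List.TFAE [
      GenDiff.coef f α = 0 ∧ GenDiff.coef f β = 0,
      ∃ m s : ℕ, 1 ≤ m ∧ 1 ≤ s ∧ GenDiff.IsSum α β s m f,
      ∃ s : ℕ, 1 ≤ s ∧ GenDiff.IsSum α β s (4 * s + 1) f,
      ∃ s : ℕ, 1 ≤ s ∧ ∃ g : GenDiff.W (2 * s), GenDiff.Ppow α β s g = f,
      ∃ s : ℕ, 1 ≤ s ∧ ∃ g : GenDiff.W 2,
        (g : GenDiff.L2) ∈ GenDiff.W (2 * s) ∧ (GenDiff.P α β 0 g : GenDiff.L2) = f]) ∧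
    -- the same for each given `s`
    (∀ s : ℕ, 1 ≤ s → ∀ f : GenDiff.L2, List.TFAE [
      GenDiff.coef f α = 0 ∧ GenDiff.coef f β = 0,
      ∃ m : ℕ, 1 ≤ m ∧ GenDiff.IsSum α β s m f,
      GenDiff.IsSum α β s (4 * s + 1) f,
      ∃ g : GenDiff.W (2 * s), GenDiff.Ppow α β s g = f]) ∧
    -- almost every choice of `b` in the cube `[0,2π]^{4s+1}` works for a given `f`
    (∀ s : ℕ, 1 ≤ s → ∀ f : GenDiff.L2, GenDiff.coef f α = 0 ∧ GenDiff.coef f β = 0 →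
      ∀ᵐ b : Fin (4 * s + 1) → ℝ ∂(MeasureTheory.volume.restrict
        (Set.univ.pi fun _ => Set.Icc (0 : ℝ) (2 * Real.pi))),
        GenDiff.IsSumWith α β s b f) ∧
    -- the functions of the form in question make up a closed subspace
    (∀ s : ℕ, 1 ≤ s → ∃ V : Submodule ℂ GenDiff.L2,
      IsClosed (V : Set GenDiff.L2) ∧
        (V : Set GenDiff.L2) = {f | GenDiff.IsSum α β s (4 * s + 1) f}) ∧
    -- five generalised differences
    (∀ f : GenDiff.L2, GenDiff.coef f α = 0 ∧ GenDiff.coef f β = 0 →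
      ∃ h : Fin 5 → GenDiff.L2,
        (∀ j, GenDiff.IsGeneralisedDifference α β (h j)) ∧ f = ∑ j, h j) := by
  refine ⟨fun f => ?_, fun s hs f => ?_, fun s _ f hf => GenDiff.ae_isSumWith α β s hf,
    fun s hs => ⟨GenDiff.vanishing α β, GenDiff.isClosed_vanishing α β, ?_⟩, fun f hf => ?_⟩
  · tfae_have 1 → 3 := fun hf => ⟨1, le_rfl, GenDiff.isSum_of_coef_eq_zero 1 hf⟩
    tfae_have 3 → 2 := fun ⟨s, hs, h⟩ => ⟨4 * s + 1, s, by omega, hs, h⟩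
    tfae_have 2 → 1 := fun ⟨_, _, _, hs, h⟩ => GenDiff.coef_eq_zero_of_isSum hs h
    tfae_have 1 → 4 := fun hf => ⟨1, le_rfl, (GenDiff.exists_Ppow_eq_iff le_rfl).2 hf⟩
    tfae_have 4 → 1 := fun ⟨_, hs, h⟩ => (GenDiff.exists_Ppow_eq_iff hs).1 h
    tfae_have 1 → 5 := fun hf => by
      obtain ⟨g, hg⟩ := GenDiff.exists_P_eq hf
      -- For `s = 1` the additional regularity is just membership in `W 2`.
      exact ⟨1, le_rfl, g, g.2, hg⟩
    tfae_have 5 → 1 := by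
      rintro ⟨_, _, g, _, rfl⟩
      exact GenDiff.coef_P_eq_zero g
    tfae_finish
  · tfae_have 1 → 3 := GenDiff.isSum_of_coef_eq_zero s
    tfae_have 3 → 2 := fun h => ⟨4 * s + 1, by omega, h⟩
    tfae_have 2 → 1 := fun ⟨_, _, h⟩ => GenDiff.coef_eq_zero_of_isSum hs h
    tfae_have 4 ↔ 1 := GenDiff.exists_Ppow_eq_iff hs
    tfae_finish
  · ext f
    exact (GenDiff.isSum_iff hs).symm
  · obtain ⟨b, hb, g, hg⟩ := GenDiff.isSum_of_coef_eq_zero 1 hf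
    refine ⟨fun j => GenDiff.conv (GenDiff.bracket α β (b j) ^ 1) (g j), fun j => ?_, hg⟩
    exact ⟨b j, hb j, (2 : ℂ) • g j, by simp only [pow_one, GenDiff.conv_bracket_eq_conv_lam]⟩
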